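/- Let $\mathcal V$ be an infinite set of individual variables, $\mathbb V$ a set of at least two fixpoint variables, and $\mathcal L$ a game signature: a first-order signature together with action symbols $\mathfrak a$, each with a pair of arities $(k,\ell)$, one of which is the $(1,0)$-ary quantifier symbol $*$. A first-order neighbourhood structure $\mathcal N$ is a first-order structure with non-empty domain $M$ together with, for each $(k,\ell)$-ary $\mathfrak a$, a map $\mathcal N(\mathfrak a)$ assigning to each $\bar u\in M^{\ell}$ an upward closed family of subsets of $M^{k}$, where $\mathcal N(*)=\mathcal P(M)\setminus\{\emptyset\}$. States are the maps $\omega:\mathcal V\to M$; let $\mathcal S$ be the set of states. For a $(k,\ell)$-ary $\mathfrak a$, a sequence $\bar x$ of $k$ pairwise distinct variables and a sequence $\bar\theta$ of $\ell$ terms, the atomic game $\mathfrak a_{\bar x}(\bar\theta)$ denotes the map $$S\mapsto\{\omega : \text{there is } E\in\mathcal N(\mathfrak a)(\bar\theta^{\omega})\text{ with }\omega[\bar x\mapsto\bar e]\in S\text{ for all }\bar e\in E\}$$ on $\mathcal P(\mathcal S)$. Let $\xi$ range over the atomic formulas $\theta_1=\theta_2$ and $R(\bar\theta)$, and write $\mathrm{lfp}\,Z.F(Z)=\bigcap\{Z\subseteq\mathcal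 S : F(Z)\subseteq Z\}$. First-order game logic (FOGL) has the formulas $\varphi::=\xi\mid\neg\varphi\mid\varphi_1\wedge\varphi_2\mid\langle\alpha\rangle\varphi$ and the games $\alpha::=\mathfrak a_{\bar x}(\bar\theta)\mid{?}\varphi\mid\alpha_1\cup\alpha_2\mid\alpha_1;\alpha_2\mid\alpha^*\mid\alpha^d$. Formulas denote subsets $[\![\varphi]\!]_{\mathcal N}$ of $\mathcal S$, with $[\![\langle\alpha\rangle\varphi]\!]=[\![\alpha]\!]([\![\varphi]\!])$ and the usual clauses for $\xi,\neg,\wedge$. Games denote maps on $\mathcal P(\mathcal S)$: $[\![{?}\varphi]\!](S)=[\![\varphi]\!]\cap S$, $[\![\alpha\cup\beta]\!](S)=[\![\alpha]\!](S)\cup[\![\beta]\!](S)$, $[\![\alpha;\beta]\!]=[\![\alpha]\!]\circ[\![\beta]\!]$, $[\![\alpha^*]\!](S)=\mathrm{lfp}\,Z.(S\cup[\![\alpha]\!](Z))$ and $[\![\alpha^d]\!](S)=\mathcal S\setminus[\![\alpha]\!](\mathcal S\setminus S)$. The first-order modal $\mu$-calculus (FOL$\mu$) has the formulas $\varphi::=X\mid\xi\mid\neg\varphi\mid\varphi_1\wedge\varphi_2\mid\langle\mathfrak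 a_{\bar x}(\bar\theta)\rangle\varphi\mid\mu X.\varphi$ with $X\in\mathbb V$, where $X$ may occur free in $\varphi$ only positively when it is bound by $\mu X.\varphi$. For an interpretation $I:\mathbb V\to\mathcal P(\mathcal S)$, $[\![X]\!]^I=I(X)$, $[\![\mu X.\varphi]\!]^I=\mathrm{lfp}\,Z.[\![\varphi]\!]^{I[X\mapsto Z]}$, and the other clauses are as above. As a logic, FOL$\mu$ consists of the formulas without free fixpoint variables, for which $I$ is irrelevant and dropped. **Theorem.** FOL$\mu$ and FOGL are equiexpressive: there are a map $F$ from FOGL formulas to FOL$\mu$ formulas and a map $G$ from FOL$\mu$ formulas to FOGL formulas such that for every first-order neighbourhood structure $\mathcal N$ for $\mathcal L$, every FOGL formula $\psi$ and every FOL$\mu$ formula $\varphi$, $$[\![\psi]\!]_{\mathcal N}=[\![F(\psi)]\!]_{\mathcal N}\qquad\text{and}\qquad[\![\varphi]\!]_{\mathcal N}=[\![G(\varphi)]\!]_{\mathcal N}.$$ -/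

import Mathlib

universe u v w x y z

/-- A game signature: a first-order signature (function and relation symbols with arities) together
with action symbols with pairs of arities `(k, l)`, among which is the quantifier action symbol
`∗` of arity `(1, 0)`. A `(k, l)`-ary action symbol has `l` parameters and affects `k` variables. -/
structure GameSignature extends FirstOrder.Language.{u, v} where
  Actions : ℕ → ℕ → Type w
  star : Actions 1 0

/-- A first-order neighbourhood structure: a nonempty first-order structure together with, for each
action symbol, a map from parameter tuples to upward closed families of sets of result tuples.
The quantifier symbol `∗` is interpreted as the family of all nonempty sets. -/
structure NbhdStructure (L : GameSignature.{u, v, w}) where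
  Dom : Type x
  [nonempty : Nonempty Dom]
  [str : L.toLanguage.Structure Dom]
  act : ∀ {k l : ℕ}, L.Actions k l → (Fin l → Dom) → Set (Set (Fin k → Dom))
  act_upward : ∀ {k l : ℕ} (a : L.Actions k l) (d : Fin l → Dom) (U W : Set (Fin k → Dom)),
    U ∈ act a d → U ⊆ W → W ∈ act a d
  act_star : ∀ d : Fin 0 → Dom, act L.star d = {U | U.Nonempty}

attribute [instance] NbhdStructure.nonempty NbhdStructure.str

/-- States: assignments of domain elements to the individual variables. -/
abbrev NbhdStructure.State {L : GameSignature.{u, v, w}} (N : NbhdStructure.{u, v, w, x} L)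
    (V : Type y) := V → N.Dom

/-- The least fixpoint operator `⋂ {Z | F Z ⊆ Z}` on sets of states. -/
def setLfp {S : Type*} (F : Set S → Set S) : Set S := ⋂₀ {Z | F Z ⊆ Z}

/-- The winning region function of the atomic game `a` with affected variables `xs` (pairwise
distinct) and parameters `ts`: Angel wins into `S` from `ω` if some achievable set `E` of result
tuples is such that every update of `ω` at `xs` by a tuple from `E` lies in `S`.
Here `Function.extend xs d ω` maps `xs i` to `d i` and agrees with `ω` off the variables `xs`. -/
def NbhdStructure.atomicGame {L : GameSignature.{u, v, w}} (N : NbhdStructure.{u, v, w, x} L)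
    {V : Type y} {k l : ℕ} (a : L.Actions k l) (xs : Fin k ↪ V)
    (ts : Fin l → L.toLanguage.Term V) (S : Set (N.State V)) : Set (N.State V) :=
  {ω | ∃ E ∈ N.act a (fun i => (ts i).realize ω), ∀ d ∈ E, Function.extend xs d ω ∈ S}

/-! ### First-order game logic -/

mutual
/-- Formulas of first-order game logic over the signature `L` with individual variables `V`. -/
inductive GLFormula (L : GameSignature.{u, v, w}) (V : Type y) : Type (max u v w y)
  | equal (s t : L.toLanguage.Term V) : GLFormula L V
  | rel {n : ℕ} (R : L.toLanguage.Relations n) (ts : Fin n → L.toLanguage.Term V) : GLFormula L V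
  | neg (φ : GLFormula L V) : GLFormula L V
  | and (φ ψ : GLFormula L V) : GLFormula L V
  | dia (α : Game L V) (φ : GLFormula L V) : GLFormula L V
/-- Games of first-order game logic: atomic games, tests `?φ`, choices `α ∪ β`, sequential
compositions `α ; β`, repetitions `α*` and duals `αᵈ`. -/
inductive Game (L : GameSignature.{u, v, w}) (V : Type y) : Type (max u v w y)
  | atom {k l : ℕ} (a : L.Actions k l) (xs : Fin k ↪ V) (ts : Fin l → L.toLanguage.Term V) :
      Game L V
  | test (φ : GLFormula L V) : Game L V
  | choice (α β : Game L V) : Game L V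
  | seq (α β : Game L V) : Game L V
  | repeat_ (α : Game L V) : Game L V
  | dual (α : Game L V) : Game L V
end

mutual
/-- The set of states in which a formula of first-order game logic holds. -/
def GLFormula.den {L : GameSignature.{u, v, w}} {V : Type y} (N : NbhdStructure.{u, v, w, x} L) :
    GLFormula L V → Set (N.State V)
  | .equal s t => {ω | s.realize ω = t.realize ω}
  | .rel R ts => {ω | FirstOrder.Language.Structure.RelMap R (fun i => (ts i).realize ω)}
  | .neg φ => (φ.den N)ᶜ
  | .and φ ψ => φ.den N ∩ ψ.den N
  | .dia α φ => α.den N (φ.den N)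
/-- The winning region function of a game: `α.den N S` is the set of states from which Angel can
force the game `α` to end in `S`. -/
def Game.den {L : GameSignature.{u, v, w}} {V : Type y} (N : NbhdStructure.{u, v, w, x} L) :
    Game L V → Set (N.State V) → Set (N.State V)
  | .atom a xs ts => fun S => N.atomicGame a xs ts S
  | .test φ => fun S => φ.den N ∩ S
  | .choice α β => fun S => α.den N S ∪ β.den N S
  | .seq α β => fun S => α.den N (β.den N S)
  | .repeat_ α => fun S => setLfp (fun Z => S ∪ α.den N Z)
  | .dual α => fun S => (α.den N Sᶜ)ᶜ
end

/-! ### The first-order modal μ-calculus -/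

/-- Raw formulas of the first-order μ-calculus over the signature `L` with individual variables `V`
and fixpoint variables `FV` (no positivity condition yet). -/
inductive PreMu (L : GameSignature.{u, v, w}) (V : Type y) (FV : Type z) : Type (max u v w y z)
  | fvar (X : FV) : PreMu L V FV
  | equal (s t : L.toLanguage.Term V) : PreMu L V FV
  | rel {n : ℕ} (R : L.toLanguage.Relations n) (ts : Fin n → L.toLanguage.Term V) : PreMu L V FV
  | neg (φ : PreMu L V FV) : PreMu L V FV
  | and (φ ψ : PreMu L V FV) : PreMu L V FV
  | dia {k l : ℕ} (a : L.Actions k l) (xs : Fin k ↪ V) (ts : Fin l → L.toLanguage.Term V)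
      (φ : PreMu L V FV) : PreMu L V FV
  | mu (X : FV) (φ : PreMu L V FV) : PreMu L V FV

namespace PreMu

variable {L : GameSignature.{u, v, w}} {V : Type y} {FV : Type z}

/-- `OccursOnly X b φ`: every free occurrence of `X` in `φ` is in the scope of an even (`b = true`)
or of an odd (`b = false`) number of negations. -/
def OccursOnly (X : FV) : Bool → PreMu L V FV → Prop
  | b, .fvar Y => Y = X → b = true
  | _, .equal _ _ => True
  | _, .rel _ _ => True
  | b, .neg φ => OccursOnly X (!b) φ
  | b, .and φ ψ => OccursOnly X b φ ∧ OccursOnly X b ψ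
  | b, .dia _ _ _ φ => OccursOnly X b φ
  | b, .mu Y φ => Y ≠ X → OccursOnly X b φ

/-- Whenever `μX.ψ` is a subformula, `X` occurs only positively in `ψ`. -/
def WellFormed : PreMu L V FV → Prop
  | .fvar _ => True
  | .equal _ _ => True
  | .rel _ _ => True
  | .neg φ => φ.WellFormed
  | .and φ ψ => φ.WellFormed ∧ ψ.WellFormed
  | .dia _ _ _ φ => φ.WellFormed
  | .mu X φ => OccursOnly X true φ ∧ φ.WellFormed

/-- The free fixpoint variables. -/
def freeFix : PreMu L V FV → Set FV
  | .fvar X => {X}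
  | .equal _ _ => ∅
  | .rel _ _ => ∅
  | .neg φ => φ.freeFix
  | .and φ ψ => φ.freeFix ∪ ψ.freeFix
  | .dia _ _ _ φ => φ.freeFix
  | .mu X φ => φ.freeFix \ {X}

open Classical in
/-- The set of states in which a formula holds under the interpretation `I` of the fixpoint
variables. -/
noncomputable def den (N : NbhdStructure.{u, v, w, x} L) :
    PreMu L V FV → (FV → Set (N.State V)) → Set (N.State V)
  | .fvar X, I => I X
  | .equal s t, _ => {ω | s.realize ω = t.realize ω}
  | .rel R ts, _ => {ω | FirstOrder.Language.Structure.RelMap R (fun i => (ts i).realize ω)}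
  | .neg φ, I => (φ.den N I)ᶜ
  | .and φ ψ, I => φ.den N I ∩ ψ.den N I
  | .dia a xs ts φ, I => N.atomicGame a xs ts (φ.den N I)
  | .mu X φ, I => setLfp (fun Z => φ.den N (Function.update I X Z))

end PreMu

/-- The formulas of the first-order μ-calculus viewed as a logic: well-formed formulas without free
fixpoint variables. -/
def MuFormula (L : GameSignature.{u, v, w}) (V : Type y) (FV : Type z) : Type (max u v w y z) :=
  {φ : PreMu L V FV // φ.WellFormed ∧ φ.freeFix = ∅}

/-- The denotation depends only on the interpretation of the free fixpoint variables. -/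
theorem PreMu.den_congr {L : GameSignature.{u, v, w}} {V : Type y} {FV : Type z}
    (N : NbhdStructure.{u, v, w, x} L) (φ : PreMu L V FV) (I J : FV → Set (N.State V))
    (h : ∀ X ∈ φ.freeFix, I X = J X) : φ.den N I = φ.den N J := by
  classical
  induction φ generalizing I J with
  | fvar X => exact h X rfl
  | equal s t => rfl
  | rel R ts => rfl
  | neg φ ih => simp only [PreMu.den]; rw [ih I J h]
  | and φ ψ ih₁ ih₂ =>
    simp only [PreMu.den]
    rw [ih₁ I J fun X hX => h X (Or.inl hX), ih₂ I J fun X hX => h X (Or.inr hX)]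
  | dia a xs ts φ ih => simp only [PreMu.den]; rw [ih I J h]
  | mu X φ ih =>
    simp only [PreMu.den]
    congr 1
    funext Z
    apply ih
    intro Y hY
    by_cases hYX : Y = X
    · simp [Function.update, hYX]
    · rw [Function.update_of_ne hYX, Function.update_of_ne hYX]
      exact h Y ⟨hY, hYX⟩

/-- The denotation of a formula without free fixpoint variables; the interpretation of the fixpoint
variables is irrelevant (see `MuFormula.den_eq`). -/
noncomputable def MuFormula.den {L : GameSignature.{u, v, w}} {V : Type y} {FV : Type z}
    (N : NbhdStructure.{u, v, w, x} L) (φ : MuFormula L V FV) : Set (N.State V) :=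
  φ.1.den N (fun _ => ∅)

theorem MuFormula.den_eq {L : GameSignature.{u, v, w}} {V : Type y} {FV : Type z}
    (N : NbhdStructure.{u, v, w, x} L) (φ : MuFormula L V FV) (I : FV → Set (N.State V)) :
    φ.den N = φ.1.den N I :=
  φ.1.den_congr N _ _ (by rw [φ.2.2]; simp)

/-! ### Expressiveness of logics -/

/-- A denotational semantics of a logic with formulas `A`, global parameters `P` and local
parameters `Q p` for each global parameter `p`. -/
abbrev DenSemantics (A : Type*) {P : Type*} (Q : P → Type*) := (p : P) → A → Set (Q p)

/-- The translation `K` is sound with respect to the global parameter `p`. -/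
def SoundAt {A B P : Type*} {Q : P → Type*} (S : DenSemantics A Q) (T : DenSemantics B Q)
    (K : A → B) (p : P) : Prop :=
  ∀ φ : A, S p φ = T p (K φ)

/-- Two logics, with the same global and local parameters, are equiexpressive if there are
translations in both directions that are sound with respect to all global parameters. (Each
translation is uniform: it depends neither on the global nor on the local parameters.) -/
def Equiexpressive {A B P : Type*} {Q : P → Type*} (S : DenSemantics A Q) (T : DenSemantics B Q) :
    Prop :=
  (∃ K : A → B, ∀ p : P, SoundAt S T K p) ∧ (∃ K : B → A, ∀ p : P, SoundAt T S K p)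

/-- The semantics of first-order game logic: structures are global, states are local parameters. -/
def glSemantics (L : GameSignature.{u, v, w}) (V : Type y) :
    DenSemantics (GLFormula L V) (fun N : NbhdStructure.{u, v, w, x} L => N.State V) :=
  fun N φ => φ.den N

/-- The semantics of the first-order μ-calculus: structures are global, states are local
parameters. -/
noncomputable def muSemantics (L : GameSignature.{u, v, w}) (V : Type y) (FV : Type z) :
    DenSemantics (MuFormula L V FV) (fun N : NbhdStructure.{u, v, w, x} L => N.State V) :=
  fun N φ => φ.den N

/-!
Game logic is translated into the μ-calculus by composing continuations: `Game.toMu` sends a game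
`α` and a formula `φ` to a formula denoting `α.den (φ.den)`. The continuation `φ` never has more
than one free fixpoint variable `X`, so that the least fixpoint which interprets a repetition can
be bound to any variable other than `X`. Hence two fixpoint variables suffice.

Conversely, a formula of the μ-calculus is turned into its own evaluation game. Over a domain with
at least two elements, fresh individual variables serve as one-bit registers: register `n` is
*raised* if it has the same value as a fixed reference variable. A subformula in the scope of `n`
fixpoint operators, counted from `0` at the outermost, becomes a game which, on reaching the
fixpoint variable bound by operator `k`, ends with `k` as the highest raised register, and which
ends with all registers lowered if Angel has already won. A least fixpoint is the game that plays
its body, and plays it again as long as its own register is raised; a fixpoint under an odd number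
of negations is the dual of such a loop (`evalGame`). The value of a formula cannot depend on the
registers, and `setLfp_eq_of_loop` shows that the fixpoint on arbitrary sets of states computed by
the loop agrees with the fixpoint of the formula, which lives on the sets that do not depend on the
registers; `evalGame_den` is the resulting correctness statement.

Over a domain with one element there is a single state, and a least fixpoint `μX.φ` has the value
of `φ` at `X = ∅` (`PreMu.toGLOfSubsingleton`). The size of the domain can be tested by a formula,
so the two translations combine into one.
-/

open Set

/-! ### Least fixpoints of monotone operators on sets -/

theorem setLfp_subset {S : Type*} {F : Set S → Set S} {Z : Set S} (h : F Z ⊆ Z) : setLfp F ⊆ Z :=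
  sInter_subset_of_mem h

theorem map_setLfp_subset {S : Type*} {F : Set S → Set S} (hF : Monotone F) :
    F (setLfp F) ⊆ setLfp F :=
  subset_sInter fun _ hZ => (hF (setLfp_subset hZ)).trans hZ

theorem map_setLfp {S : Type*} {F : Set S → Set S} (hF : Monotone F) :
    F (setLfp F) = setLfp F :=
  (map_setLfp_subset hF).antisymm (setLfp_subset (hF (map_setLfp_subset hF)))

theorem setLfp_mono {S : Type*} {F G : Set S → Set S} (h : ∀ Z, F Z ⊆ G Z) :
    setLfp F ⊆ setLfp G :=
  subset_sInter fun Z hZ => setLfp_subset ((h Z).trans hZ)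

/-! ### Monotonicity of games and formulas -/

theorem NbhdStructure.atomicGame_mono {L : GameSignature.{u, v, w}}
    (N : NbhdStructure.{u, v, w, x} L) {V : Type y} {k l : ℕ} (a : L.Actions k l) (xs : Fin k ↪ V)
    (ts : Fin l → L.toLanguage.Term V) : Monotone (N.atomicGame a xs ts) := by
  rintro A B h ω ⟨E, hE, hd⟩
  exact ⟨E, hE, fun d hdE => h (hd d hdE)⟩

theorem Game.den_mono {L : GameSignature.{u, v, w}} {V : Type y}
    (N : NbhdStructure.{u, v, w, x} L) : ∀ α : Game L V, Monotone (α.den N)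
  | .atom a xs ts => by simpa only [Game.den] using N.atomicGame_mono a xs ts
  | .test φ => fun A B h => by
    simp only [Game.den]
    exact inter_subset_inter_right _ h
  | .choice α β => fun A B h => by
    simp only [Game.den]
    exact union_subset_union (Game.den_mono N α h) (Game.den_mono N β h)
  | .seq α β => fun A B h => by
    simp only [Game.den]
    exact Game.den_mono N α (Game.den_mono N β h)
  | .repeat_ α => fun A B h => by
    simp only [Game.den]
    exact setLfp_mono fun Z => union_subset_union_left _ h
  | .dual α => fun A B h => by
    simp only [Game.den]
    exact compl_subset_compl.2 (Game.den_mono N α (compl_subset_compl.2 h))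

/-- `A` for the sign `true`, and the complement of `A` for the sign `false`. -/
def signed {S : Type*} (b : Bool) (A : Set S) : Set S := bif b then A else Aᶜ

theorem signed_not {S : Type*} (b : Bool) (A : Set S) : signed (!b) A = signed b Aᶜ := by
  cases b <;> simp [signed]

namespace PreMu

variable {L : GameSignature.{u, v, w}} {V : Type y} {FV : Type z}

theorem OccursOnly.of_notMem_freeFix {X : FV} {φ : PreMu L V FV} (h : X ∉ φ.freeFix) (b : Bool) :
    OccursOnly X b φ := by
  induction φ generalizing b with
  | fvar Y => exact fun hY => (h hY.symm).elim
  | equal s t => trivial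
  | rel R ts => trivial
  | neg φ ih => exact ih h _
  | and φ ψ ih₁ ih₂ => exact ⟨ih₁ (fun hX => h (Or.inl hX)) b, ih₂ (fun hX => h (Or.inr hX)) b⟩
  | dia a xs ts φ ih => exact ih h b
  | mu Y φ ih => exact fun hY => ih (fun hX => h ⟨hX, fun hXY => hY hXY.symm⟩) b

open Classical in
theorem OccursOnly.signed_den_mono (N : NbhdStructure.{u, v, w, x} L) {X : FV}
    {φ : PreMu L V FV} {b : Bool} (h : OccursOnly X b φ) {I : FV → Set (N.State V)}
    {A B : Set (N.State V)} (hAB : A ⊆ B) :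
    signed b (φ.den N (Function.update I X A)) ⊆ signed b (φ.den N (Function.update I X B)) := by
  induction φ generalizing b I with
  | fvar Y =>
    by_cases hY : Y = X
    · obtain rfl : b = true := h hY
      subst hY
      simpa [signed, PreMu.den] using hAB
    · simp [PreMu.den, Function.update_of_ne hY]
  | equal s t => exact subset_rfl
  | rel R ts => exact subset_rfl
  | neg φ ih =>
    have := ih (I := I) h
    rwa [signed_not, signed_not] at this
  | and φ ψ ih₁ ih₂ =>
    have h₁ := ih₁ (I := I) h.1
    have h₂ := ih₂ (I := I) h.2
    cases b
    · simp only [signed, PreMu.den, cond_false, compl_inter] at *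
      exact union_subset_union h₁ h₂
    · exact inter_subset_inter h₁ h₂
  | dia a xs ts φ ih =>
    have := ih (I := I) h
    cases b
    · simp only [signed, PreMu.den, cond_false, compl_subset_compl] at *
      exact N.atomicGame_mono a xs ts this
    · exact N.atomicGame_mono a xs ts this
  | mu Y φ ih =>
    by_cases hY : Y = X
    · subst hY
      simp [PreMu.den]
    · have key : ∀ Z, signed b (φ.den N (Function.update (Function.update I X A) Y Z)) ⊆
          signed b (φ.den N (Function.update (Function.update I X B) Y Z)) := fun Z => by
        rw [Function.update_comm (Ne.symm hY), Function.update_comm (Ne.symm hY)]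
        exact ih (h hY)
      cases b
      · simp only [signed, PreMu.den, cond_false, compl_subset_compl] at *
        exact setLfp_mono key
      · exact setLfp_mono key

open Classical in
theorem OccursOnly.den_mono (N : NbhdStructure.{u, v, w, x} L) {X : FV} {φ : PreMu L V FV}
    (h : OccursOnly X true φ) (I : FV → Set (N.State V)) :
    Monotone fun Z => φ.den N (Function.update I X Z) :=
  fun _ _ hAB => h.signed_den_mono N hAB

/-! ### From game logic to the μ-calculus -/

/-- Disjunction in the μ-calculus. -/
def or (φ ψ : PreMu L V FV) : PreMu L V FV := .neg (.and (.neg φ) (.neg ψ))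

theorem den_or (N : NbhdStructure.{u, v, w, x} L) (φ ψ : PreMu L V FV)
    (I : FV → Set (N.State V)) : (φ.or ψ).den N I = φ.den N I ∪ ψ.den N I := by
  simp [PreMu.or, PreMu.den, compl_inter]

theorem occursOnly_or (X : FV) (b : Bool) (φ ψ : PreMu L V FV) :
    OccursOnly X b (φ.or ψ) ↔ OccursOnly X b φ ∧ OccursOnly X b ψ := by
  simp [PreMu.or, OccursOnly]

end PreMu

section ToMu

variable {L : GameSignature.{u, v, w}} {V : Type y} {FV : Type z}

mutual
/-- The translation of game logic into the μ-calculus. The function `o` chooses, for every fixpoint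
variable, another one; `X` is an arbitrary fixpoint variable. -/
def GLFormula.toMu (o : FV → FV) (X : FV) : GLFormula L V → PreMu L V FV
  | .equal s t => .equal s t
  | .rel R ts => .rel R ts
  | .neg φ => .neg (φ.toMu o X)
  | .and φ ψ => .and (φ.toMu o X) (ψ.toMu o X)
  | .dia α φ => α.toMu o X X (φ.toMu o X)
/-- The formula `α.toMu o X₀ X φ` of the μ-calculus expresses `⟨α⟩φ` for a formula `φ` of the
μ-calculus with no free fixpoint variable except `X`. The fixpoint of a repetition binds `o X`, and
its body is again a continuation with a single free variable. The tests in `α` are closed formulas;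
they are translated with the starting variable `X₀`. -/
def Game.toMu (o : FV → FV) (X₀ : FV) : Game L V → FV → PreMu L V FV → PreMu L V FV
  | .atom a xs ts => fun _ φ => .dia a xs ts φ
  | .test ψ => fun _ φ => .and (ψ.toMu o X₀) φ
  | .choice α β => fun X φ => .or (α.toMu o X₀ X φ) (β.toMu o X₀ X φ)
  | .seq α β => fun X φ => α.toMu o X₀ X (β.toMu o X₀ X φ)
  | .repeat_ α => fun X φ => .mu (o X) (.or φ (α.toMu o X₀ (o X) (.fvar (o X))))
  | .dual α => fun X φ => .neg (α.toMu o X₀ X (.neg φ))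
end

mutual
/-- Translations of formulas are closed; this and the positivity in `Game.toMu_spec` make the
fixpoints that translate repetitions well-formed. -/
theorem GLFormula.toMu_spec {o : FV → FV} (ho : ∀ X, o X ≠ X) (X : FV) : ∀ φ : GLFormula L V,
    (φ.toMu o X).freeFix = ∅ ∧ (φ.toMu o X).WellFormed
  | .equal s t => ⟨rfl, trivial⟩
  | .rel R ts => ⟨rfl, trivial⟩
  | .neg φ => GLFormula.toMu_spec ho X φ
  | .and φ ψ => by
    have h₁ := GLFormula.toMu_spec ho X φ
    have h₂ := GLFormula.toMu_spec ho X ψ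
    simp [GLFormula.toMu, PreMu.freeFix, PreMu.WellFormed, h₁, h₂]
  | .dia α φ => by
    have h := GLFormula.toMu_spec ho X φ
    have hα := Game.toMu_spec ho X α X (φ.toMu o X) (by simp [h.1]) h.2
    exact ⟨subset_empty_iff.1 (h.1 ▸ hα.1), hα.2.1⟩
theorem Game.toMu_spec {o : FV → FV} (ho : ∀ X, o X ≠ X) (X₀ : FV) : ∀ (α : Game L V) (X : FV)
    (φ : PreMu L V FV), φ.freeFix ⊆ {X} → φ.WellFormed →
    (α.toMu o X₀ X φ).freeFix ⊆ φ.freeFix ∧ (α.toMu o X₀ X φ).WellFormed ∧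
      ∀ b, PreMu.OccursOnly X b φ → PreMu.OccursOnly X b (α.toMu o X₀ X φ)
  | .atom a xs ts, X, φ, _, hw => ⟨subset_rfl, hw, fun _ h => h⟩
  | .test ψ, X, φ, _, hw => by
    have h := GLFormula.toMu_spec ho X₀ ψ
    refine ⟨by simp [Game.toMu, PreMu.freeFix, h.1], ⟨h.2, hw⟩, fun b hb => ⟨?_, hb⟩⟩
    exact PreMu.OccursOnly.of_notMem_freeFix (by simp [h.1]) b
  | .choice α β, X, φ, hf, hw => by
    have h₁ := Game.toMu_spec ho X₀ α X φ hf hw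
    have h₂ := Game.toMu_spec ho X₀ β X φ hf hw
    exact ⟨union_subset h₁.1 h₂.1, ⟨h₁.2.1, h₂.2.1⟩,
      fun b hb => (PreMu.occursOnly_or ..).2 ⟨h₁.2.2 b hb, h₂.2.2 b hb⟩⟩
  | .seq α β, X, φ, hf, hw => by
    have h₂ := Game.toMu_spec ho X₀ β X φ hf hw
    have h₁ := Game.toMu_spec ho X₀ α X _ (h₂.1.trans hf) h₂.2.1
    exact ⟨h₁.1.trans h₂.1, h₁.2.1, fun b hb => h₁.2.2 b (h₂.2.2 b hb)⟩
  | .repeat_ α, X, φ, hf, hw => by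
    have h := Game.toMu_spec ho X₀ α (o X) (.fvar (o X)) subset_rfl trivial
    have hX : o X ∉ φ.freeFix := fun hX => ho X (hf hX)
    have hfree : (Game.toMu o X₀ (.repeat_ α) X φ).freeFix ⊆ φ.freeFix := by
      rintro Y ⟨hY | hY, hYX⟩
      · exact hY
      · exact (hYX (h.1 hY)).elim
    refine ⟨hfree, ⟨?_, hw, h.2.1⟩, fun b hb _ => ?_⟩
    · exact (PreMu.occursOnly_or ..).2
        ⟨PreMu.OccursOnly.of_notMem_freeFix hX _, h.2.2 true fun _ => rfl⟩
    · refine (PreMu.occursOnly_or ..).2 ⟨hb, PreMu.OccursOnly.of_notMem_freeFix ?_ _⟩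
      exact fun hX' => ho X (h.1 hX').symm
  | .dual α, X, φ, hf, hw => by
    have h := Game.toMu_spec ho X₀ α X (.neg φ) hf hw
    refine ⟨h.1, h.2.1, fun b hb => h.2.2 (!b) ?_⟩
    simpa [PreMu.OccursOnly] using hb
end

mutual
theorem GLFormula.den_toMu (N : NbhdStructure.{u, v, w, x} L) {o : FV → FV} (ho : ∀ X, o X ≠ X)
    (X : FV) : ∀ (φ : GLFormula L V) (I : FV → Set (N.State V)),
    (φ.toMu o X).den N I = φ.den N
  | .equal s t, I => by simp only [GLFormula.toMu, PreMu.den, GLFormula.den]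
  | .rel R ts, I => by simp only [GLFormula.toMu, PreMu.den, GLFormula.den]
  | .neg φ, I => by
    simp only [GLFormula.toMu, PreMu.den, GLFormula.den, GLFormula.den_toMu N ho X φ]
  | .and φ ψ, I => by
    simp only [GLFormula.toMu, PreMu.den, GLFormula.den, GLFormula.den_toMu N ho X φ,
      GLFormula.den_toMu N ho X ψ]
  | .dia α φ, I => by
    have h := GLFormula.toMu_spec ho X φ
    simp only [GLFormula.toMu, GLFormula.den]
    rw [Game.den_toMu N ho X α X _ (by simp [h.1]) h.2, GLFormula.den_toMu N ho X φ]
theorem Game.den_toMu (N : NbhdStructure.{u, v, w, x} L) {o : FV → FV} (ho : ∀ X, o X ≠ X)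
    (X₀ : FV) : ∀ (α : Game L V) (X : FV) (φ : PreMu L V FV), φ.freeFix ⊆ {X} → φ.WellFormed →
    ∀ I : FV → Set (N.State V), (α.toMu o X₀ X φ).den N I = α.den N (φ.den N I)
  | .atom a xs ts, X, φ, _, _, I => by simp only [Game.toMu, PreMu.den, Game.den]
  | .test ψ, X, φ, _, _, I => by
    simp only [Game.toMu, PreMu.den, Game.den, GLFormula.den_toMu N ho X₀ ψ]
  | .choice α β, X, φ, hf, hw, I => by
    simp only [Game.toMu, PreMu.den_or, Game.den, Game.den_toMu N ho X₀ α X φ hf hw,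
      Game.den_toMu N ho X₀ β X φ hf hw]
  | .seq α β, X, φ, hf, hw, I => by
    have h := Game.toMu_spec ho X₀ β X φ hf hw
    simp only [Game.toMu, Game.den]
    rw [Game.den_toMu N ho X₀ α X _ (h.1.trans hf) h.2.1, Game.den_toMu N ho X₀ β X φ hf hw]
  | .repeat_ α, X, φ, hf, _, I => by
    classical
    simp only [Game.toMu, PreMu.den, PreMu.den_or, Game.den]
    congr 1
    funext Z
    rw [Game.den_toMu N ho X₀ α (o X) (.fvar (o X)) subset_rfl trivial]
    congr 1
    · refine PreMu.den_congr N φ _ _ fun Y hY => Function.update_of_ne ?_ _ _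
      rintro rfl
      exact ho X (hf hY)
    · simp [PreMu.den]
  | .dual α, X, φ, hf, hw, I => by
    simp only [Game.toMu, PreMu.den, Game.den, Game.den_toMu N ho X₀ α X (.neg φ) hf hw]
end

end ToMu

/-! ### Formulas and the values of variables outside a set of registers -/

section Registers

variable {L : GameSignature.{u, v, w}} {V : Type y} {FV : Type z}

/-- The individual variables that occur in a term. -/
def termVars {L : FirstOrder.Language.{u, v}} {V : Type y} : L.Term V → Set V
  | .var v => {v}
  | .func _ ts => ⋃ i, termVars (ts i)

theorem finite_termVars {L : FirstOrder.Language.{u, v}} {V : Type y} (t : L.Term V) :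
    (termVars t).Finite := by
  induction t with
  | var v => exact finite_singleton v
  | func f ts ih => exact finite_iUnion ih

theorem realize_congr_of_termVars {L : FirstOrder.Language.{u, v}} {V : Type y} {M : Type x}
    [L.Structure M] {t : L.Term V} {ω ω' : V → M} (h : ∀ v ∈ termVars t, ω v = ω' v) :
    t.realize ω = t.realize ω' := by
  induction t with
  | var v => exact h v rfl
  | func f ts ih =>
    simp only [FirstOrder.Language.Term.realize]
    congr 1
    funext i
    exact ih i fun v hv => h v (mem_iUnion.2 ⟨i, hv⟩)

/-- The individual variables that occur in the terms of a formula. Variables that are only assigned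
to are not included, as the meaning of a formula does not depend on their values. -/
def PreMu.vars : PreMu L V FV → Set V
  | .fvar _ => ∅
  | .equal s t => termVars s ∪ termVars t
  | .rel _ ts => ⋃ i, termVars (ts i)
  | .neg φ => φ.vars
  | .and φ ψ => φ.vars ∪ ψ.vars
  | .dia _ _ ts φ => (⋃ i, termVars (ts i)) ∪ φ.vars
  | .mu _ φ => φ.vars

theorem PreMu.finite_vars (φ : PreMu L V FV) : φ.vars.Finite := by
  induction φ with
  | fvar X => exact finite_empty
  | equal s t => exact (finite_termVars s).union (finite_termVars t)
  | rel R ts => exact finite_iUnion fun i => finite_termVars _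
  | neg φ ih => exact ih
  | and φ ψ ih₁ ih₂ => exact ih₁.union ih₂
  | dia a xs ts φ ih => exact (finite_iUnion fun i => finite_termVars _).union ih
  | mu X φ ih => exact ih

/-- Membership in `A` does not depend on the values of the variables in `B`. -/
def IndepOf {M : Type x} (B : Set V) (A : Set (V → M)) : Prop :=
  ∀ ω ω' : V → M, EqOn ω ω' Bᶜ → ω ∈ A → ω' ∈ A

/-- The largest subset of `A` for which membership does not depend on the values in `B`. -/
def indepInterior {M : Type x} (B : Set V) (A : Set (V → M)) : Set (V → M) :=
  {ω | ∀ ω', EqOn ω ω' Bᶜ → ω' ∈ A}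

theorem indepOf_indepInterior {M : Type x} (B : Set V) (A : Set (V → M)) :
    IndepOf B (indepInterior B A) :=
  fun _ _ h hω ω'' h' => hω ω'' (h.trans h')

theorem indepInterior_subset {M : Type x} (B : Set V) (A : Set (V → M)) :
    indepInterior B A ⊆ A :=
  fun ω hω => hω ω fun _ _ => rfl

theorem IndepOf.subset_indepInterior {M : Type x} {B : Set V} {A C : Set (V → M)}
    (hA : IndepOf B A) (h : A ⊆ C) : A ⊆ indepInterior B C :=
  fun ω hω ω' hω' => h (hA ω ω' hω' hω)

theorem IndepOf.compl {M : Type x} {B : Set V} {A : Set (V → M)} (h : IndepOf B A) :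
    IndepOf B Aᶜ :=
  fun ω ω' hω hA hA' => hA (h ω' ω hω.symm hA')

theorem IndepOf.update_mem_iff [DecidableEq V] {M : Type x} {B : Set V} {A : Set (V → M)}
    (h : IndepOf B A) {v : V} (hv : v ∈ B) (ω : V → M) (m : M) :
    Function.update ω v m ∈ A ↔ ω ∈ A := by
  have : EqOn (Function.update ω v m) ω Bᶜ := fun u hu =>
    Function.update_of_ne (by rintro rfl; exact hu hv) _ _
  exact ⟨h _ _ this, h _ _ this.symm⟩

/-- The least fixpoint of a monotone operator that preserves independence is independent, since the
independent interior of the fixpoint is again closed under the operator. -/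
theorem indepOf_setLfp {M : Type x} {B : Set V} {F : Set (V → M) → Set (V → M)}
    (hF : Monotone F) (hB : ∀ Z, IndepOf B Z → IndepOf B (F Z)) : IndepOf B (setLfp F) := by
  have h : setLfp F ⊆ indepInterior B (setLfp F) := by
    refine setLfp_subset ((hB _ (indepOf_indepInterior B _)).subset_indepInterior ?_)
    exact (hF (indepInterior_subset B _)).trans (map_setLfp_subset hF)
  rw [h.antisymm (indepInterior_subset B _)]
  exact indepOf_indepInterior B _

theorem PreMu.indepOf_den (N : NbhdStructure.{u, v, w, x} L) {B : Set V} {φ : PreMu L V FV}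
    (hw : φ.WellFormed) (hB : Disjoint φ.vars B) {I : FV → Set (N.State V)}
    (hI : ∀ X ∈ φ.freeFix, IndepOf B (I X)) : IndepOf B (φ.den N I) := by
  classical
  have realize_eq : ∀ {t : L.toLanguage.Term V} {ω ω' : N.State V}, Disjoint (termVars t) B →
      EqOn ω ω' Bᶜ → t.realize ω = t.realize ω' := fun ht hω =>
    realize_congr_of_termVars fun v hv => hω (disjoint_left.1 ht hv)
  induction φ generalizing I with
  | fvar X => exact hI X rfl
  | equal s t =>
    intro ω ω' hω h
    obtain ⟨hs, ht⟩ := disjoint_union_left.1 hB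
    simp only [PreMu.den, mem_ofPred_eq] at h ⊢
    rwa [← realize_eq hs hω, ← realize_eq ht hω]
  | rel R ts =>
    intro ω ω' hω h
    simp only [PreMu.den, mem_ofPred_eq] at h ⊢
    simp only [PreMu.vars, disjoint_iUnion_left] at hB
    simpa only [← realize_eq (hB _) hω] using h
  | neg φ ih => exact (ih hw hB hI).compl
  | and φ ψ ih₁ ih₂ =>
    intro ω ω' hω h
    obtain ⟨h₁, h₂⟩ := disjoint_union_left.1 hB
    exact ⟨ih₁ hw.1 h₁ (fun X hX => hI X (Or.inl hX)) ω ω' hω h.1,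
      ih₂ hw.2 h₂ (fun X hX => hI X (Or.inr hX)) ω ω' hω h.2⟩
  | dia a xs ts φ ih =>
    rintro ω ω' hω ⟨E, hE, h⟩
    obtain ⟨hts, hφ⟩ := disjoint_union_left.1 hB
    simp only [disjoint_iUnion_left] at hts
    refine ⟨E, by simpa only [← realize_eq (hts _) hω] using hE, fun d hd => ?_⟩
    refine ih hw hφ hI _ _ (fun v hv => ?_) (h d hd)
    by_cases hx : ∃ i, xs i = v
    · obtain ⟨i, rfl⟩ := hx
      rw [xs.injective.extend_apply, xs.injective.extend_apply]
    · rw [Function.extend_apply' _ _ _ hx, Function.extend_apply' _ _ _ hx]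
      exact hω hv
  | mu X φ ih =>
    refine indepOf_setLfp (hw.1.den_mono N I) fun Z hZ => ih hw.2 hB fun Y hY => ?_
    by_cases hYX : Y = X
    · subst hYX
      simpa using hZ
    · simpa [Function.update_of_ne hYX] using hI Y ⟨hY, hYX⟩

/-- The loop on `γ` continues from the states in `C` and stops at the others. If, on target sets
`C ∩ B ∪ Cᶜ ∩ S` with `B` independent of the registers, `γ` computes the operator `F`, then the
loop computes the least fixpoint of `F`, although the loop's own fixpoint ranges over arbitrary
sets. -/
theorem setLfp_eq_of_loop {M : Type x} {R : Set V} {F γ : Set (V → M) → Set (V → M)}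
    {C S : Set (V → M)} (hγ : Monotone γ) (hF : Monotone F)
    (hR : ∀ B, IndepOf R B → IndepOf R (F B))
    (h : ∀ B, IndepOf R B → γ (C ∩ B ∪ Cᶜ ∩ S) = F B) :
    γ (setLfp fun Z => Cᶜ ∩ S ∪ C ∩ γ Z) = setLfp F := by
  have hmono : Monotone fun Z => Cᶜ ∩ S ∪ C ∩ γ Z := fun A B hAB =>
    union_subset_union_right _ (inter_subset_inter_right _ (hγ hAB))
  have hlfp := h _ (indepOf_setLfp hF hR)
  rw [map_setLfp hF] at hlfp
  refine Subset.antisymm ?_ ?_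
  · refine Subset.trans (hγ (setLfp_subset ?_)) hlfp.subset
    rw [hlfp, union_comm]
  · set Y := γ (setLfp fun Z => Cᶜ ∩ S ∪ C ∩ γ Z) with hY
    -- The independent interior of `Y` is closed under `F`.
    refine (setLfp_subset ((hR _ (indepOf_indepInterior R Y)).subset_indepInterior ?_)).trans
      (indepInterior_subset R Y)
    rw [← h _ (indepOf_indepInterior R Y)]
    refine hγ (Subset.trans ?_ (map_setLfp_subset hmono))
    rw [union_comm]
    exact union_subset_union_right _ (inter_subset_inter_right _ (indepInterior_subset R Y))

/-! ### Games on registers -/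

/-- The game in which Angel assigns a value of her choice to `v`. -/
def Game.assignAny (v : V) : Game L V :=
  .atom L.star ⟨fun _ => v, fun _ _ _ => Subsingleton.elim _ _⟩ Fin.elim0

theorem Game.mem_den_assignAny [DecidableEq V] (N : NbhdStructure.{u, v, w, x} L) (v : V)
    (S : Set (N.State V)) (ω : N.State V) :
    ω ∈ (Game.assignAny v : Game L V).den N S ↔ ∃ m, Function.update ω v m ∈ S := by
  have hext : ∀ d : Fin 1 → N.Dom,
      Function.extend (⟨fun _ => v, fun _ _ _ => Subsingleton.elim _ _⟩ : Fin 1 ↪ V) d ω =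
        Function.update ω v (d 0) := by
    intro d
    funext u
    by_cases hu : u = v
    · subst hu
      have hinj : Function.Injective fun _ : Fin 1 => u := fun _ _ _ => Subsingleton.elim _ _
      rw [Function.update_self]
      exact hinj.extend_apply d ω 0
    · rw [Function.update_of_ne hu, Function.extend_apply']
      rintro ⟨_, rfl⟩
      exact hu rfl
  simp only [Game.assignAny, Game.den, NbhdStructure.atomicGame, N.act_star, mem_ofPred_eq]
  constructor
  · rintro ⟨E, ⟨d, hd⟩, h⟩
    exact ⟨d 0, hext d ▸ h d hd⟩
  · rintro ⟨m, hm⟩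
    refine ⟨{fun _ => m}, singleton_nonempty _, ?_⟩
    rintro d rfl
    exact (hext _).symm ▸ hm

/-- The formula saying that register `n` is raised. The registers are the variables `e (n + 1)`,
and `e 0` is the reference variable with which they are compared. -/
def raised (L : GameSignature.{u, v, w}) (e : ℕ → V) (n : ℕ) : GLFormula L V :=
  .equal (.var (e (n + 1))) (.var (e 0))

theorem mem_den_raised (N : NbhdStructure.{u, v, w, x} L) (e : ℕ → V) (n : ℕ) (ω : N.State V) :
    ω ∈ (raised L e n).den N ↔ ω (e (n + 1)) = ω (e 0) := by
  simp [raised, GLFormula.den]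

/-- The game that raises register `n`. -/
def raise (L : GameSignature.{u, v, w}) (e : ℕ → V) (n : ℕ) : Game L V :=
  .seq (.assignAny (e (n + 1))) (.test (raised L e n))

/-- The game that lowers register `n`. -/
def lower (L : GameSignature.{u, v, w}) (e : ℕ → V) (n : ℕ) : Game L V :=
  .seq (.assignAny (e (n + 1))) (.test (.neg (raised L e n)))

/-- The game after which `k` is the highest raised register among the first `n`, or, if `n ≤ k`,
none of them is raised. -/
def exitTo (L : GameSignature.{u, v, w}) (e : ℕ → V) (k : ℕ) : ℕ → Game L V
  | 0 => .test (.equal (.var (e 0)) (.var (e 0)))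
  | n + 1 =>
    if k = n then raise L e n else .seq (exitTo L e k n) (lower L e n)

/-- The states `ω` in which either none of the first `n` registers is raised, or `ω ∈ J k` for the
highest raised one, `k`. -/
def exitSet (N : NbhdStructure.{u, v, w, x} L) (e : ℕ → V) (J : ℕ → Set (N.State V)) :
    ℕ → Set (N.State V)
  | 0 => univ
  | n + 1 => (raised L e n).den N ∩ J n ∪ ((raised L e n).den N)ᶜ ∩ exitSet N e J n

theorem exitSet_congr (N : NbhdStructure.{u, v, w, x} L) (e : ℕ → V) {J J' : ℕ → Set (N.State V)}
    {n : ℕ} (h : ∀ k < n, J k = J' k) : exitSet N e J n = exitSet N e J' n := by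
  induction n with
  | zero => rfl
  | succ n ih =>
    simp only [exitSet]
    rw [h n n.lt_succ_self, ih fun k hk => h k (hk.trans n.lt_succ_self)]

theorem exitSet_succ_update (N : NbhdStructure.{u, v, w, x} L) (e : ℕ → V)
    (J : ℕ → Set (N.State V)) (n : ℕ) (A : Set (N.State V)) :
    exitSet N e (Function.update J n A) (n + 1) =
      (raised L e n).den N ∩ A ∪ ((raised L e n).den N)ᶜ ∩ exitSet N e J n := by
  simp only [exitSet, Function.update_self]
  rw [exitSet_congr N e fun k hk => Function.update_of_ne hk.ne _ _]

theorem update_mem_exitSet_iff [DecidableEq V] (N : NbhdStructure.{u, v, w, x} L) {e : ℕ → V}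
    (he : Function.Injective e) {J : ℕ → Set (N.State V)} {n m : ℕ} (hnm : n ≤ m)
    (hJ : ∀ k < n, IndepOf (range e) (J k)) (ω : N.State V) (d : N.Dom) :
    Function.update ω (e (m + 1)) d ∈ exitSet N e J n ↔ ω ∈ exitSet N e J n := by
  induction n with
  | zero => simp [exitSet]
  | succ n ih =>
    have h₁ : e (n + 1) ≠ e (m + 1) := fun h => by have := he h; omega
    have h₂ : e 0 ≠ e (m + 1) := fun h => by have := he h; omega
    simp only [exitSet, mem_union, mem_inter_iff, mem_compl_iff, mem_den_raised,
      Function.update_of_ne h₁, Function.update_of_ne h₂,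
      (hJ n n.lt_succ_self).update_mem_iff (mem_range_self (m + 1)),
      ih (by omega) fun k hk => hJ k (hk.trans n.lt_succ_self)]

theorem mem_den_raise [DecidableEq V] (N : NbhdStructure.{u, v, w, x} L) {e : ℕ → V}
    (he : Function.Injective e) (n : ℕ) (S : Set (N.State V)) (ω : N.State V) :
    ω ∈ (raise L e n).den N S ↔ Function.update ω (e (n + 1)) (ω (e 0)) ∈ S := by
  have h₀ : e 0 ≠ e (n + 1) := fun h => by have := he h; omega
  simp only [raise, Game.den, Game.mem_den_assignAny, mem_inter_iff, mem_den_raised,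
    Function.update_self, Function.update_of_ne h₀, exists_eq_left]

theorem mem_den_lower [DecidableEq V] (N : NbhdStructure.{u, v, w, x} L) {e : ℕ → V}
    (he : Function.Injective e) (n : ℕ) (S : Set (N.State V)) (ω : N.State V) :
    ω ∈ (lower L e n).den N S ↔ ∃ m ≠ ω (e 0), Function.update ω (e (n + 1)) m ∈ S := by
  have h₀ : e 0 ≠ e (n + 1) := fun h => by have := he h; omega
  simp only [lower, Game.den, GLFormula.den, Game.mem_den_assignAny, mem_inter_iff, mem_compl_iff,
    mem_den_raised, Function.update_self, Function.update_of_ne h₀, ne_eq]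

theorem den_lower_exitSet (N : NbhdStructure.{u, v, w, x} L) [Nontrivial N.Dom] {e : ℕ → V}
    (he : Function.Injective e) {J : ℕ → Set (N.State V)} {n : ℕ}
    (hJ : ∀ k < n, IndepOf (range e) (J k)) :
    (lower L e n).den N (exitSet N e J (n + 1)) = exitSet N e J n := by
  classical
  have h₀ : e 0 ≠ e (n + 1) := fun h => by have := he h; omega
  ext ω
  rw [mem_den_lower N he]
  have key : ∀ m, m ≠ ω (e 0) →
      (Function.update ω (e (n + 1)) m ∈ exitSet N e J (n + 1) ↔ ω ∈ exitSet N e J n) := by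
    intro m hm
    simp only [exitSet, mem_union, mem_inter_iff, mem_compl_iff, mem_den_raised,
      Function.update_self, Function.update_of_ne h₀, hm, false_and, false_or, not_false_eq_true,
      true_and, update_mem_exitSet_iff N he le_rfl hJ]
  constructor
  · rintro ⟨m, hm, h⟩
    exact (key m hm).1 h
  · intro h
    obtain ⟨m, hm⟩ := exists_ne (ω (e 0))
    exact ⟨m, hm, (key m hm).2 h⟩

theorem den_exitTo_of_le (N : NbhdStructure.{u, v, w, x} L) [Nontrivial N.Dom] {e : ℕ → V}
    (he : Function.Injective e) {J : ℕ → Set (N.State V)} {n k : ℕ} (hk : n ≤ k)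
    (hJ : ∀ k < n, IndepOf (range e) (J k)) :
    (exitTo L e k n).den N (exitSet N e J n) = univ := by
  induction n with
  | zero => simp [exitTo, exitSet, Game.den, GLFormula.den]
  | succ n ih =>
    have hJ' : ∀ k < n, IndepOf (range e) (J k) := fun k hk => hJ k (hk.trans n.lt_succ_self)
    simp only [exitTo, if_neg (show k ≠ n by omega), Game.den]
    rw [den_lower_exitSet N he hJ', ih (by omega) hJ']

theorem den_exitTo_of_lt (N : NbhdStructure.{u, v, w, x} L) [Nontrivial N.Dom] {e : ℕ → V}
    (he : Function.Injective e) {J : ℕ → Set (N.State V)} {n k : ℕ} (hk : k < n)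
    (hJ : ∀ k < n, IndepOf (range e) (J k)) :
    (exitTo L e k n).den N (exitSet N e J n) = J k := by
  classical
  induction n with
  | zero => omega
  | succ n ih =>
    have hJ' : ∀ k < n, IndepOf (range e) (J k) := fun k hk => hJ k (hk.trans n.lt_succ_self)
    by_cases hkn : k = n
    · subst hkn
      have h₀ : e 0 ≠ e (k + 1) := fun h => by have := he h; omega
      ext ω
      simp only [exitTo, if_true, mem_den_raise N he, exitSet, mem_union, mem_inter_iff,
        mem_compl_iff, mem_den_raised, Function.update_self, Function.update_of_ne h₀,
        not_true, false_and, or_false, true_and,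
        (hJ k hk).update_mem_iff (mem_range_self (k + 1))]
    · simp only [exitTo, if_neg hkn, Game.den]
      rw [den_lower_exitSet N he hJ', ih (by omega) hJ']

/-! ### Evaluation games over domains with two elements -/

/-- The game that plays `α`, and plays it again as long as register `n` is raised. -/
def loop (e : ℕ → V) (n : ℕ) (α : Game L V) : Game L V :=
  .seq α (.seq (.repeat_ (.seq (.test (raised L e n)) α)) (.test (.neg (raised L e n))))

theorem den_loop (N : NbhdStructure.{u, v, w, x} L) (e : ℕ → V) (n : ℕ) (α : Game L V)
    (S : Set (N.State V)) :
    (loop e n α).den N S = α.den N (setLfp fun Z =>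
      ((raised L e n).den N)ᶜ ∩ S ∪ (raised L e n).den N ∩ α.den N Z) := by
  simp only [loop, Game.den, GLFormula.den]

open Classical in
/-- The evaluation game of `φ` (if `b` is `true`) or of the negation of `φ` (if `b` is `false`) in
the scope of `n` fixpoint operators, where the free variable `X` is bound by the operator with
number `ρ X`. A fixpoint variable is evaluated in the same way for both values of `b`, namely by
leaving the game with register `ρ X` raised: once negations are pushed inwards, dualizing the
fixpoint operators on the way, all bound occurrences are positive. -/
noncomputable def evalGame (e : ℕ → V) : PreMu L V FV → Bool → ℕ → (FV → ℕ) → Game L V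
  | .fvar X, _, n, ρ => exitTo L e (ρ X) n
  | .equal s t, true, n, _ => .seq (.test (.equal s t)) (exitTo L e n n)
  | .equal s t, false, n, _ => .seq (.test (.neg (.equal s t))) (exitTo L e n n)
  | .rel R ts, true, n, _ => .seq (.test (.rel R ts)) (exitTo L e n n)
  | .rel R ts, false, n, _ => .seq (.test (.neg (.rel R ts))) (exitTo L e n n)
  | .neg φ, b, n, ρ => evalGame e φ (!b) n ρ
  | .and φ ψ, true, n, ρ =>
    .dual (.choice (.dual (evalGame e φ true n ρ)) (.dual (evalGame e ψ true n ρ)))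
  | .and φ ψ, false, n, ρ => .choice (evalGame e φ false n ρ) (evalGame e ψ false n ρ)
  | .dia a xs ts φ, true, n, ρ => .seq (.atom a xs ts) (evalGame e φ true n ρ)
  | .dia a xs ts φ, false, n, ρ => .seq (.dual (.atom a xs ts)) (evalGame e φ false n ρ)
  | .mu X φ, true, n, ρ => loop e n (evalGame e φ true (n + 1) (Function.update ρ X n))
  | .mu X φ, false, n, ρ =>
    .dual (loop e n (.dual (evalGame e φ false (n + 1) (Function.update ρ X n))))

open Classical in
/-- Correctness of the evaluation game: to end a play of `evalGame e φ b n ρ` in `exitSet N e J n`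
is to satisfy `φ`, or its negation, according to `b`. For every free variable `X` there is a sign
`s` such that `X` occurs positively (with respect to the evaluated formula) if `s` is `true` and
negatively otherwise, and `J (ρ X)` is `I X` or its complement accordingly. -/
theorem evalGame_den (N : NbhdStructure.{u, v, w, x} L) [Nontrivial N.Dom] {e : ℕ → V}
    (he : Function.Injective e) {φ : PreMu L V FV} (hw : φ.WellFormed)
    (hv : Disjoint φ.vars (range e)) {b : Bool} {n : ℕ} {ρ : FV → ℕ} {I : FV → Set (N.State V)}
    {J : ℕ → Set (N.State V)} (hJ : ∀ k < n, IndepOf (range e) (J k))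
    (hρ : ∀ X ∈ φ.freeFix, ρ X < n ∧
      ∃ s : Bool, PreMu.OccursOnly X (b == s) φ ∧ J (ρ X) = signed s (I X)) :
    (evalGame e φ b n ρ).den N (exitSet N e J n) = signed b (φ.den N I) := by
  induction φ generalizing b n ρ I J with
  | fvar X =>
    obtain ⟨hn, s, hs, h⟩ := hρ X rfl
    have hbs : (b == s) = true := hs rfl
    obtain rfl : b = s := by simpa using hbs
    rw [evalGame, den_exitTo_of_lt N he hn hJ, h, PreMu.den]
  | equal s t =>
    cases b <;>
    simp [evalGame, Game.den, den_exitTo_of_le N he le_rfl hJ, GLFormula.den, PreMu.den, signed]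
  | rel R ts =>
    cases b <;>
    simp [evalGame, Game.den, den_exitTo_of_le N he le_rfl hJ, GLFormula.den, PreMu.den, signed]
  | neg φ ih =>
    rw [evalGame, ih hw hv hJ, signed_not, PreMu.den]
    intro X hX
    obtain ⟨hn, s, hs, h⟩ := hρ X hX
    refine ⟨hn, s, ?_, h⟩
    cases b <;> cases s <;> exact hs
  | and φ ψ ih₁ ih₂ =>
    obtain ⟨hv₁, hv₂⟩ := disjoint_union_left.1 hv
    have h₁ := ih₁ hw.1 hv₁ hJ fun X hX => by
      obtain ⟨hn, s, hs, h⟩ := hρ X (Or.inl hX)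
      exact ⟨hn, s, hs.1, h⟩
    have h₂ := ih₂ hw.2 hv₂ hJ fun X hX => by
      obtain ⟨hn, s, hs, h⟩ := hρ X (Or.inr hX)
      exact ⟨hn, s, hs.2, h⟩
    cases b <;> simp [evalGame, Game.den, h₁, h₂, signed, PreMu.den, compl_inter]
  | dia a xs ts φ ih =>
    have h := ih hw (disjoint_union_left.1 hv).2 hJ hρ
    cases b <;> simp [evalGame, Game.den, h, signed, PreMu.den]
  | mu X φ ih =>
    -- The free variables other than `X` keep their meaning when the operator is entered.
    have hρ' : ∀ (B B' : Set (N.State V)), B' = signed b B → ∀ Y ∈ φ.freeFix,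
        Function.update ρ X n Y < n + 1 ∧ ∃ s : Bool, PreMu.OccursOnly Y (b == s) φ ∧
          Function.update J n B' (Function.update ρ X n Y) =
            signed s (Function.update I X B Y) := by
      intro B B' hB Y hY
      by_cases hYX : Y = X
      · subst hYX
        refine ⟨by simp, b, ?_, by simpa using hB⟩
        rw [beq_self_eq_true]
        exact hw.1
      · obtain ⟨hn, s, hs, h⟩ := hρ Y ⟨hY, hYX⟩
        rw [Function.update_of_ne hYX, Function.update_of_ne hYX, Function.update_of_ne hn.ne]
        exact ⟨by omega, s, hs (Ne.symm hYX), h⟩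
    have hJ' : ∀ B, IndepOf (range e) B →
        ∀ k < n + 1, IndepOf (range e) (Function.update J n B k) := by
      intro B hB k hk
      by_cases hkn : k = n
      · subst hkn
        simpa using hB
      · rw [Function.update_of_ne hkn]
        exact hJ k (by omega)
    have hI : ∀ B, IndepOf (range e) B → ∀ Y ∈ φ.freeFix,
        IndepOf (range e) (Function.update I X B Y) := by
      intro B hB Y hY
      by_cases hYX : Y = X
      · subst hYX
        simpa using hB
      · obtain ⟨hn, s, -, h⟩ := hρ Y ⟨hY, hYX⟩
        rw [Function.update_of_ne hYX]
        have := hJ _ hn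
        cases s
        · rw [h] at this
          simpa [signed] using this.compl
        · rwa [h] at this
    have hR : ∀ B, IndepOf (range e) B →
        IndepOf (range e) (φ.den N (Function.update I X B)) := fun B hB =>
      PreMu.indepOf_den N hw.2 hv (hI B hB)
    cases b
    · simp only [evalGame, Game.den, den_loop, signed, cond_false, PreMu.den]
      congr 1
      refine setLfp_eq_of_loop (γ := fun Z => ((evalGame e φ false (n + 1)
        (Function.update ρ X n)).den N Zᶜ)ᶜ) ?_ (hw.1.den_mono N I) hR fun B hB => ?_
      · exact fun A B hAB => compl_subset_compl.2 (Game.den_mono N _ (compl_subset_compl.2 hAB))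
      · have h := ih hw.2 hv (hJ' _ hB.compl) (hρ' B Bᶜ rfl)
        rw [exitSet_succ_update] at h
        simp only [signed, cond_false] at h
        rw [compl_eq_comm, ← h]
        congr 1
        ext ω
        simp only [mem_union, mem_inter_iff, mem_compl_iff]
        tauto
    · simp only [evalGame, den_loop, signed, cond_true, PreMu.den]
      refine setLfp_eq_of_loop (Game.den_mono N _) (hw.1.den_mono N I) hR fun B hB => ?_
      have h := ih hw.2 hv (hJ' _ hB) (hρ' B B rfl)
      rwa [exitSet_succ_update] at h

end Registers

/-! ### Domains with one element -/

section Subsingleton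

variable {L : GameSignature.{u, v, w}} {V : Type y} {FV : Type z}

open Classical in
/-- The translation of the μ-calculus which is correct over domains with one element: least
fixpoints `μX.φ` are replaced by `φ` with the false formula `⊥` for `X`. The formula `ρ X` is
substituted for the free variable `X`. -/
noncomputable def PreMu.toGLOfSubsingleton (bot : GLFormula L V) :
    PreMu L V FV → (FV → GLFormula L V) → GLFormula L V
  | .fvar X, ρ => ρ X
  | .equal s t, _ => .equal s t
  | .rel R ts, _ => .rel R ts
  | .neg φ, ρ => .neg (φ.toGLOfSubsingleton bot ρ)
  | .and φ ψ, ρ => .and (φ.toGLOfSubsingleton bot ρ) (ψ.toGLOfSubsingleton bot ρ)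
  | .dia a xs ts φ, ρ => .dia (.atom a xs ts) (φ.toGLOfSubsingleton bot ρ)
  | .mu X φ, ρ => φ.toGLOfSubsingleton bot (Function.update ρ X bot)

theorem setLfp_of_subsingleton {S : Type*} [Subsingleton S] {F : Set S → Set S}
    (hF : Monotone F) : setLfp F = F ∅ := by
  refine Subset.antisymm (setLfp_subset ?_) (subset_sInter fun Z hZ => (hF Z.empty_subset).trans hZ)
  rcases (F ∅).eq_empty_or_nonempty with h | h
  · rw [h, h]
  · rw [Subsingleton.eq_univ_of_nonempty h]
    exact subset_univ _

theorem PreMu.den_toGLOfSubsingleton (N : NbhdStructure.{u, v, w, x} L) [Subsingleton N.Dom]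
    {bot : GLFormula L V} (hbot : bot.den N = ∅) {φ : PreMu L V FV} (hw : φ.WellFormed)
    (ρ : FV → GLFormula L V) :
    (φ.toGLOfSubsingleton bot ρ).den N = φ.den N fun X => (ρ X).den N := by
  classical
  induction φ generalizing ρ with
  | fvar X => rfl
  | equal s t => simp only [PreMu.toGLOfSubsingleton, PreMu.den, GLFormula.den]
  | rel R ts => simp only [PreMu.toGLOfSubsingleton, PreMu.den, GLFormula.den]
  | neg φ ih => simp only [PreMu.toGLOfSubsingleton, PreMu.den, GLFormula.den, ih hw]
  | and φ ψ ih₁ ih₂ =>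
    simp only [PreMu.toGLOfSubsingleton, PreMu.den, GLFormula.den, ih₁ hw.1, ih₂ hw.2]
  | dia a xs ts φ ih =>
    simp only [PreMu.toGLOfSubsingleton, PreMu.den, GLFormula.den, Game.den, ih hw]
  | mu X φ ih =>
    simp only [PreMu.toGLOfSubsingleton, PreMu.den]
    rw [ih hw.2, setLfp_of_subsingleton (hw.1.den_mono N _)]
    congr 1
    funext Y
    by_cases hY : Y = X
    · subst hY
      simpa using hbot
    · simp [Function.update_of_ne hY]

end Subsingleton

/-! ### Equiexpressiveness -/

section ToGL

variable {L : GameSignature.{u, v, w}} {V : Type y}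

/-- The formula saying that the domain has two distinct elements. -/
def twoElements (L : GameSignature.{u, v, w}) (e : ℕ → V) : GLFormula L V :=
  .dia (.assignAny (e 0)) (.dia (.assignAny (e 1)) (.neg (raised L e 0)))

theorem den_twoElements (N : NbhdStructure.{u, v, w, x} L) {e : ℕ → V}
    (he : Function.Injective e) :
    (twoElements L e).den N = {_ω | Nontrivial N.Dom} := by
  classical
  have h₀ : e 0 ≠ e 1 := fun h => by have := he h; omega
  ext ω
  simp only [twoElements, GLFormula.den, Game.mem_den_assignAny, mem_compl_iff, mem_den_raised,
    zero_add, Function.update_self, Function.update_of_ne h₀, mem_ofPred_eq]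
  exact ⟨fun ⟨a, b, h⟩ => ⟨b, a, h⟩, fun ⟨b, a, h⟩ => ⟨a, b, h⟩⟩

/-- The formula `(χ ∧ φ) ∨ (¬χ ∧ ψ)`. -/
def GLFormula.cases (χ φ ψ : GLFormula L V) : GLFormula L V :=
  .neg (.and (.neg (.and χ φ)) (.neg (.and (.neg χ) ψ)))

theorem GLFormula.den_cases (N : NbhdStructure.{u, v, w, x} L) (χ φ ψ : GLFormula L V) :
    (χ.cases φ ψ).den N = χ.den N ∩ φ.den N ∪ (χ.den N)ᶜ ∩ ψ.den N := by
  simp only [GLFormula.cases, GLFormula.den]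
  rw [compl_inter, compl_compl, compl_compl]

theorem MuFormula.exists_glFormula [Infinite V] {FV : Type z} (φ : MuFormula L V FV) :
    ∃ ψ : GLFormula L V, ∀ N : NbhdStructure.{u, v, w, x} L, φ.den N = ψ.den N := by
  obtain ⟨φ, hw, hf⟩ := φ
  have : Infinite ↥(φ.vars)ᶜ := φ.finite_vars.infinite_compl.to_subtype
  let e : ℕ → V := fun n => Infinite.natEmbedding ↥(φ.vars)ᶜ n
  have he : Function.Injective e :=
    Subtype.val_injective.comp (Infinite.natEmbedding ↥(φ.vars)ᶜ).injective
  have hv : Disjoint φ.vars (range e) := by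
    rw [disjoint_right]
    rintro _ ⟨n, rfl⟩
    exact (Infinite.natEmbedding ↥(φ.vars)ᶜ n).2
  let top : GLFormula L V := .equal (.var (e 0)) (.var (e 0))
  refine ⟨(twoElements L e).cases (.dia (evalGame e φ true 0 fun _ => 0) top)
    (φ.toGLOfSubsingleton (.neg top) fun _ => .neg top), fun N => ?_⟩
  have htop : top.den N = univ := by simp [top, GLFormula.den]
  rw [GLFormula.den_cases, den_twoElements N he]
  rcases subsingleton_or_nontrivial N.Dom with h | h
  · have hbot : (GLFormula.neg top).den N = ∅ := by simp [GLFormula.den, htop]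
    rw [PreMu.den_toGLOfSubsingleton N hbot hw]
    simp [not_nontrivial_iff_subsingleton.2 h, hbot, MuFormula.den]
  · have key := evalGame_den N he hw hv (b := true) (n := 0) (ρ := fun _ => 0)
      (I := fun _ => ∅) (J := fun _ => ∅) (fun k hk => absurd hk k.not_lt_zero) (by simp [hf])
    simp only [exitSet] at key
    simp [h, GLFormula.den, htop, key, MuFormula.den, signed]

end ToGL

theorem mainTheorem2 (L : GameSignature.{u, v, w}) (V : Type y) [Infinite V]
    (FV : Type z) [Nontrivial FV] :
    Equiexpressive (muSemantics.{u, v, w, x, y, z} L V FV) (glSemantics.{u, v, w, x, y} L V) := by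
  constructor
  · choose K hK using fun φ : MuFormula L V FV => φ.exists_glFormula
    exact ⟨K, fun N φ => hK φ N⟩
  · choose o ho using fun X : FV => exists_ne X
    obtain ⟨X⟩ : Nonempty FV := inferInstance
    refine ⟨fun φ => ⟨φ.toMu o X, (φ.toMu_spec ho X).2, (φ.toMu_spec ho X).1⟩, fun N φ => ?_⟩
    exact (φ.den_toMu N ho X _).symm
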